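/- For $n\ge 1$ let $\mathfrak S_n$ be the set of permutations of $[n]=\{1,\dots,n\}$, and let $\mathfrak S=\bigcup_{n\ge1}\mathfrak S_n$. For $\sigma\in\mathfrak S_n$ and $\tau\in\mathfrak S_k$ let $\Lambda(\tau,\sigma)$ be the number of $k$-tuples $1\le x_1<\dots<x_k\le n$ such that for all $i,j\in[k]$ one has $\sigma(x_i)\le\sigma(x_j)$ if and only if $\tau(i)\le\tau(j)$. Put $t(\tau,\sigma)=\binom nk^{-1}\Lambda(\tau,\sigma)$ if $n\ge k$, and $t(\tau,\sigma)=0$ otherwise. A sequence $(\sigma_n)_{n\to\infty}$ of permutations with $\sigma_n\in\mathfrak S_n$ for every $n$ is called convergent if $\lim_{n\to\infty}t(\tau,\sigma_n)$ exists for every $\tau\in\mathfrak S$. A permuton is a probability measure $\mu$ on the Borel $\sigma$-algebra of $[0,1]\times[0,1]$ with uniform marginals, that is, $\mu(A\times[0,1])=\mu([0,1]\times A)=\lambda(A)$ for every measurable $A\subseteq[0,1]$, where $\lambda$ is Lebesgue measure. For a permuton $\mu$ and $\tau\in\mathfrak S_k$ put $$t(\tau,\mu)=k!\int \mathbf 1\{x_1<\dots<x_k,\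 y_{\tau^{-1}(1)}<\dots<y_{\tau^{-1}(k)}\}\,\mathrm d\mu^{(k)}\big((x_1,y_1),\dots,(x_k,y_k)\big),$$ where $\mu^{(k)}=\mu\otimes\dots\otimes\mu$ is the $k$-fold product measure on $([0,1]\times[0,1])^k$. Theorem. For every convergent sequence of permutations $(\sigma_n)_{n\to\infty}$ there exists a permuton $\mu$ such that $t(\tau,\sigma_n)\to t(\tau,\mu)$ as $n\to\infty$ for every $\tau\in\mathfrak S$. -/

import Mathlib

open Filter Topology MeasureTheory

namespace PermLimit

/-- The set of occurrences of the pattern `τ` in the permutation `σ`: the strictly increasing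
`k`-tuples of positions on which `σ` has the same relative order as `τ`. -/
def occurrences {k n : ℕ} (τ : Equiv.Perm (Fin k)) (σ : Equiv.Perm (Fin n)) :
    Set (Fin k → Fin n) :=
  {x | StrictMono x ∧ ∀ i j : Fin k, σ (x i) ≤ σ (x j) ↔ τ i ≤ τ j}

/-- `Λ(τ, σ)`, the number of copies of `τ` in `σ`. -/
noncomputable def copies {k n : ℕ} (τ : Equiv.Perm (Fin k)) (σ : Equiv.Perm (Fin n)) : ℕ :=
  (occurrences τ σ).ncard

/-- `t(τ, σ)`, the density of copies of `τ` in `σ`. -/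
noncomputable def density {k n : ℕ} (τ : Equiv.Perm (Fin k)) (σ : Equiv.Perm (Fin n)) : ℝ :=
  if k ≤ n then ((n.choose k : ℕ) : ℝ)⁻¹ * (copies τ σ : ℝ) else 0

/-- A sequence of permutations, the `n`-th one of order `n`, is convergent if every pattern
density has a limit. -/
def IsConvergent (σ : (n : ℕ) → Equiv.Perm (Fin n)) : Prop :=
  ∀ (k : ℕ) (τ : Equiv.Perm (Fin k)),
    ∃ L : ℝ, Tendsto (fun n : ℕ => density τ (σ n)) atTop (𝓝 L)

/-- A permuton: a Borel probability measure on the unit square with uniform marginals. -/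
structure IsPermuton (μ : Measure (unitInterval × unitInterval)) : Prop where
  isProbabilityMeasure : IsProbabilityMeasure μ
  fst_uniform : ∀ A : Set unitInterval, MeasurableSet A → μ (A ×ˢ Set.univ) = volume A
  snd_uniform : ∀ A : Set unitInterval, MeasurableSet A → μ (Set.univ ×ˢ A) = volume A

/-- The configurations of `k` points `(x₁, y₁), …, (x_k, y_k)` of the unit square with
`x₁ < ⋯ < x_k` and `y_{τ⁻¹(1)} < ⋯ < y_{τ⁻¹(k)}`. -/
def patternSet {k : ℕ} (τ : Equiv.Perm (Fin k)) : Set (Fin k → unitInterval × unitInterval) :=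
  {z | StrictMono (fun i : Fin k => (z i).1) ∧ StrictMono (fun i : Fin k => (z (τ⁻¹ i)).2)}

/-- `t(τ, μ)`, the density of `τ` in `μ`: `k!` times the mass that the `k`-fold product of `μ`
gives to the configurations with pattern `τ`. -/
noncomputable def permutonDensity {k : ℕ} (τ : Equiv.Perm (Fin k))
    (μ : Measure (unitInterval × unitInterval)) : ℝ :=
  (k.factorial : ℝ) * (Measure.pi (fun _ : Fin k => μ)).real (patternSet τ)

/-- Convergence of a sequence of permutations to `μ` in all pattern densities. -/
def ConvergesTo (σ : (n : ℕ) → Equiv.Perm (Fin n))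
    (μ : Measure (unitInterval × unitInterval)) : Prop :=
  ∀ (k : ℕ) (τ : Equiv.Perm (Fin k)),
    Tendsto (fun n : ℕ => density τ (σ n)) atTop (𝓝 (permutonDensity τ μ))

end PermLimit

namespace PermLimit

open ProbabilityTheory unitInterval

/-! Spread mass uniformly over the rescaled graph of each permutation. The square is compact, so
these measures have a weakly convergent subsequence. Their marginals are uniform on a grid and tend
to Lebesgue measure (`tendsto_gridMeasure`), so the limit is a permuton. For a permuton ties between
coordinates have probability zero, so the boundary of a pattern event is null and pattern densities
pass to the limit (`tendsto_permutonDensity`). For the graph of a permutation they agree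
asymptotically with `density`. Convergence of the full sequence is assumed, so the subsequential
limit suffices. -/

/-- The point `i / n` of the unit interval. -/
noncomputable def gridPoint {n : ℕ} (i : Fin n) : I :=
  ⟨(i : ℝ) / n, by positivity, div_le_one_of_le₀ (by exact_mod_cast i.is_lt.le) (by positivity)⟩

lemma gridPoint_strictMono {n : ℕ} : StrictMono (gridPoint : Fin n → I) := by
  intro i j hij
  have hn : (0 : ℝ) < n := by exact_mod_cast (Nat.zero_le _).trans_lt i.is_lt
  exact Subtype.mk_lt_mk.2 (div_lt_div_of_pos_right (by exact_mod_cast hij) hn)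

/-- The uniform probability measure on `Fin n`. -/
noncomputable abbrev uniformFin (n : ℕ) : Measure (Fin n) := uniformOn Set.univ

instance isProbabilityMeasure_uniformFin (n : ℕ) [NeZero n] :
    IsProbabilityMeasure (uniformFin n) :=
  isProbabilityMeasure_uniformOn Set.finite_univ Set.univ_nonempty

lemma uniformFin_singleton {n : ℕ} (i : Fin n) : uniformFin n {i} = (n : ENNReal)⁻¹ := by
  simp [uniformFin, uniformOn_univ]

lemma map_perm_uniformFin {n : ℕ} (π : Equiv.Perm (Fin n)) :
    (uniformFin n).map π = uniformFin n := by
  refine Measure.ext_of_singleton fun a => ?_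
  rw [Measure.map_apply (measurable_of_finite _) (measurableSet_singleton a)]
  have : π ⁻¹' {a} = {π.symm a} := by
    ext x
    simp [Equiv.eq_symm_apply]
  rw [this, uniformFin_singleton, uniformFin_singleton]

/-- The uniform probability measure on the grid `0, 1 / n, …, (n - 1) / n`. -/
noncomputable def gridMeasure (n : ℕ) [NeZero n] : ProbabilityMeasure I :=
  ⟨(uniformFin n).map gridPoint,
    Measure.isProbabilityMeasure_map (measurable_of_finite _).aemeasurable⟩

/-- The point `(i / n, π i / n)` of the graph of `π`, rescaled to the unit square. -/
noncomputable def graphPoint {n : ℕ} (π : Equiv.Perm (Fin n)) (i : Fin n) : I × I :=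
  (gridPoint i, gridPoint (π i))

/-- The uniform probability measure on the rescaled graph of a permutation. -/
noncomputable def graphMeasure {n : ℕ} [NeZero n] (π : Equiv.Perm (Fin n)) :
    ProbabilityMeasure (I × I) :=
  ⟨(uniformFin n).map (graphPoint π),
    Measure.isProbabilityMeasure_map (measurable_of_finite _).aemeasurable⟩

lemma map_fst_graphMeasure {n : ℕ} [NeZero n] (π : Equiv.Perm (Fin n)) :
    (graphMeasure π).map measurable_fst.aemeasurable = gridMeasure n := by
  apply Subtype.ext
  change ((uniformFin n).map (graphPoint π)).map Prod.fst = (uniformFin n).map gridPoint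
  rw [Measure.map_map measurable_fst (measurable_of_finite _)]
  rfl

lemma map_snd_graphMeasure {n : ℕ} [NeZero n] (π : Equiv.Perm (Fin n)) :
    (graphMeasure π).map measurable_snd.aemeasurable = gridMeasure n := by
  apply Subtype.ext
  change ((uniformFin n).map (graphPoint π)).map Prod.snd = (uniformFin n).map gridPoint
  rw [Measure.map_map measurable_snd (measurable_of_finite _)]
  conv_rhs => rw [← map_perm_uniformFin π]
  rw [Measure.map_map (measurable_of_finite _) (measurable_of_finite _)]
  rfl

/-! ### Grid measures converge to Lebesgue measure -/

lemma integral_gridMeasure (n : ℕ) [NeZero n] (f : I → ℝ) (hf : Continuous f) :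
    ∫ x, f x ∂(gridMeasure n : Measure I) = ∑ i : Fin n, (n : ℝ)⁻¹ * f (gridPoint i) := by
  change ∫ x, f x ∂((uniformFin n).map gridPoint) = _
  rw [integral_map (measurable_of_finite _).aemeasurable hf.aestronglyMeasurable,
    integral_fintype .of_finite]
  simp [Measure.real, uniformFin_singleton]

lemma integral_unitInterval (f : I → ℝ) :
    ∫ x, f x = ∫ x in (0 : ℝ)..1, f (Set.projIcc 0 1 zero_le_one x) := by
  rw [intervalIntegral.integral_of_le zero_le_one, ← integral_Icc_eq_integral_Ioc,
    ← integral_subtype measurableSet_Icc]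
  simp

/-- The uniform distribution on the unit interval. -/
noncomputable def uniformLaw : ProbabilityMeasure I :=
  ⟨volume, inferInstance⟩

lemma tendsto_gridMeasure :
    Tendsto (fun n : ℕ => gridMeasure (n + 1)) atTop (𝓝 uniformLaw) := by
  rw [ProbabilityMeasure.tendsto_iff_forall_integral_tendsto]
  intro f
  rw [Metric.tendsto_atTop]
  intro ε hε
  obtain ⟨δ, hδ, hfδ⟩ := Metric.uniformContinuous_iff.1
    (CompactSpace.uniformContinuous_of_continuous f.continuous) (ε / 2) (half_pos hε)
  obtain ⟨N, hN⟩ := exists_nat_one_div_lt hδ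
  refine ⟨N, fun n hn => ?_⟩
  -- Extending `f` to the line turns its integral into a sum over the cells between grid points, to
  -- be compared with a left Riemann sum.
  set g : ℝ → ℝ := fun x => f (Set.projIcc 0 1 zero_le_one x)
  have hgc : Continuous g := f.continuous.comp continuous_projIcc
  set a : ℕ → ℝ := fun i => (i : ℝ) / (n + 1 : ℕ) with ha
  have hn0 : (0 : ℝ) < (n + 1 : ℕ) := by positivity
  have hstep : ∀ i, a (i + 1) - a i = ((n + 1 : ℕ) : ℝ)⁻¹ := fun i => by
    simp only [ha]; push_cast; field_simp; ring
  have hsum := intervalIntegral.sum_integral_adjacent_intervals (f := g) (μ := volume)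
    (a := a) (n := n + 1) fun k _ => hgc.intervalIntegrable _ _
  have ha0 : a 0 = 0 := by simp [ha]
  have ha1 : a (n + 1) = 1 := div_self hn0.ne'
  have hmesh : ((n + 1 : ℕ) : ℝ)⁻¹ < δ := by
    refine lt_of_le_of_lt ?_ hN
    rw [one_div]
    gcongr
    push_cast
    gcongr
  rw [integral_gridMeasure _ _ f.continuous]
  change dist _ (∫ x, f x) < ε
  rw [integral_unitInterval]
  change dist _ (∫ x in (0 : ℝ)..1, g x) < ε
  rw [ha0, ha1] at hsum
  rw [← hsum, ← Fin.sum_univ_eq_sum_range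
    (fun i => ∫ x in a i..a (i + 1), g x), Real.dist_eq, ← Finset.sum_sub_distrib]
  -- A cell is shorter than `δ`, so `f` varies by at most `ε / 2` on it.
  have hterm : ∀ i : Fin (n + 1), |((n + 1 : ℕ) : ℝ)⁻¹ * f (gridPoint i) -
      ∫ x in a i..a (i + 1), g x| ≤ ε / 2 * ((n + 1 : ℕ) : ℝ)⁻¹ := by
    intro i
    have hconst : ((n + 1 : ℕ) : ℝ)⁻¹ * f (gridPoint i) =
        ∫ _ in a i..a (i + 1), f (gridPoint i) := by
      rw [intervalIntegral.integral_const, hstep, smul_eq_mul]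
    rw [hconst, ← intervalIntegral.integral_sub (by simp) (hgc.intervalIntegrable _ _)]
    have hle : a i ≤ a (i + 1) := by
      have := hstep i
      have : (0 : ℝ) < ((n + 1 : ℕ) : ℝ)⁻¹ := inv_pos.2 hn0
      linarith
    have hpt : gridPoint i = Set.projIcc 0 1 zero_le_one (a i) :=
      (Set.projIcc_of_mem _ (gridPoint i).2).symm
    rw [← Real.norm_eq_abs]
    refine (intervalIntegral.norm_integral_le_of_norm_le_const (C := ε / 2) ?_).trans_eq ?_
    · intro x hx
      rw [Set.uIoc_of_le hle] at hx
      rw [hpt, ← dist_eq_norm]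
      refine (hfδ ?_).le
      refine lt_of_le_of_lt ?_ hmesh
      have := (LipschitzWith.projIcc (zero_le_one' ℝ)).dist_le_mul (a i) x
      refine this.trans ?_
      rw [NNReal.coe_one, one_mul, dist_comm, Real.dist_eq, abs_of_pos (by linarith [hx.1]),
        ← hstep i]
      linarith [hx.2]
    · rw [hstep, abs_of_pos (inv_pos.2 hn0)]
  calc _ ≤ ∑ i : Fin (n + 1), ε / 2 * ((n + 1 : ℕ) : ℝ)⁻¹ :=
        (Finset.abs_sum_le_sum_abs _ _).trans (Finset.sum_le_sum fun i _ => hterm i)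
    _ = ε / 2 := by
        rw [Finset.sum_const, Finset.card_univ, Fintype.card_fin, nsmul_eq_mul]
        field_simp
    _ < ε := half_lt_self hε

lemma map_eq_volume_of_tendsto {ι : Type*} {l : Filter ι} [l.NeBot]
    {ν : ι → ProbabilityMeasure (I × I)} {μ : ProbabilityMeasure (I × I)}
    (h : Tendsto ν l (𝓝 μ)) {p : I × I → I} (hp : Continuous p)
    (hν : Tendsto (fun i => (ν i).map hp.measurable.aemeasurable) l (𝓝 uniformLaw)) :
    (μ : Measure (I × I)).map p = volume :=
  congrArg (fun m : ProbabilityMeasure I => (m : Measure I)) (tendsto_nhds_unique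
    (ProbabilityMeasure.tendsto_map_of_tendsto_of_continuous ν μ h hp) hν)

lemma isPermuton_of_map_eq {μ : Measure (I × I)} [IsProbabilityMeasure μ]
    (h₁ : μ.map Prod.fst = volume) (h₂ : μ.map Prod.snd = volume) : IsPermuton μ where
  isProbabilityMeasure := inferInstance
  fst_uniform A hA := by
    rw [← h₁, Measure.map_apply measurable_fst hA, Set.prod_univ]
  snd_uniform A hA := by
    rw [← h₂, Measure.map_apply measurable_snd hA, Set.univ_prod]

lemma IsPermuton.map_fst {μ : Measure (I × I)} (h : IsPermuton μ) :
    μ.map Prod.fst = volume := by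
  ext A hA
  rw [← h.fst_uniform A hA, Measure.map_apply measurable_fst hA, Set.prod_univ]

lemma IsPermuton.map_snd {μ : Measure (I × I)} (h : IsPermuton μ) :
    μ.map Prod.snd = volume := by
  ext A hA
  rw [← h.snd_uniform A hA, Measure.map_apply measurable_snd hA, Set.univ_prod]

/-! ### Null boundaries of pattern events -/

/-- Independent coordinates with a law without atoms are almost surely distinct. -/
lemma measure_pi_setOf_not_injective {ι α : Type*} [Fintype ι] {mα : MeasurableSpace α}
    (μ : Measure α) [IsProbabilityMeasure μ] {p : α → I} (hp : Measurable p)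
    (hμ : μ.map p = volume) :
    Measure.pi (fun _ : ι => μ) {z | ¬ Function.Injective fun i => p (z i)} = 0 := by
  have hsub : {z : ι → α | ¬ Function.Injective fun i => p (z i)} ⊆
      ⋃ (i : ι) (j : ι) (_ : i ≠ j), {z | p (z i) = p (z j)} := by
    intro z hz
    simp only [Function.Injective, Set.mem_ofPred_eq, not_forall] at hz
    obtain ⟨i, j, hij, hne⟩ := hz
    simp only [Set.mem_iUnion]
    exact ⟨i, j, hne, hij⟩
  refine measure_mono_null hsub ?_
  simp only [measure_iUnion_null_iff]
  intro i j hij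
  have hm : ∀ i : ι, Measurable fun z : ι → α => p (z i) := fun i =>
    hp.comp (measurable_pi_apply i)
  have hlaw : ∀ i : ι, (Measure.pi fun _ : ι => μ).map (fun z => p (z i)) = volume := by
    intro i
    have h := (measurePreserving_eval (fun _ : ι => μ) i).map_eq
    calc _ = ((Measure.pi fun _ : ι => μ).map (Function.eval i)).map p :=
          (Measure.map_map hp (measurable_pi_apply i)).symm
      _ = volume := by rw [h, hμ]
  have hind : IndepFun (fun z : ι → α => p (z i)) (fun z => p (z j))
      (Measure.pi fun _ : ι => μ) :=
    (iIndepFun_pi (μ := fun _ : ι => μ) (X := fun _ => p) fun _ => hp.aemeasurable).indepFun hij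
  rw [indepFun_iff_map_prod_eq_prod_map_map (hm i).aemeasurable (hm j).aemeasurable,
    hlaw, hlaw] at hind
  have hdiag : MeasurableSet {q : I × I | q.1 = q.2} := measurableSet_diagonal
  -- Fubini: every section of the diagonal is a single point.
  have h0 : (volume.prod volume : Measure (I × I)) {q | q.1 = q.2} = 0 := by
    rw [Measure.measure_prod_null hdiag]
    refine Eventually.of_forall fun x => ?_
    have : Prod.mk x ⁻¹' {q : I × I | q.1 = q.2} = {x} := by
      ext y
      simp [eq_comm]
    simp only [this, Pi.zero_apply]
    exact measure_singleton x
  rw [← hind, Measure.map_apply ((hm i).prodMk (hm j)) hdiag] at h0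
  exact h0

lemma isOpen_setOf_strictMono {k : ℕ} : IsOpen {x : Fin k → I | StrictMono x} := by
  simp only [StrictMono, Set.ofPred_forall]
  refine isOpen_iInter_of_finite fun i => isOpen_iInter_of_finite fun j =>
    isOpen_iInter_of_finite fun _ => isOpen_lt (continuous_apply i) (continuous_apply j)

/-- Strict inequalities become weak in the closure, and weak ones without ties are strict again. -/
lemma frontier_patternSet_subset {k : ℕ} (τ : Equiv.Perm (Fin k)) :
    frontier (patternSet τ) ⊆
      {z | ¬ Function.Injective fun i => (z i).1} ∪ {z | ¬ Function.Injective fun i => (z i).2} := by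
  have hc₁ : Continuous fun (z : Fin k → I × I) i => (z i).1 := by fun_prop
  have hc₂ : Continuous fun (z : Fin k → I × I) i => (z (τ⁻¹ i)).2 := by fun_prop
  have hopen : IsOpen (patternSet τ) :=
    (isOpen_setOf_strictMono.preimage hc₁).inter (isOpen_setOf_strictMono.preimage hc₂)
  have hcl : closure (patternSet τ) ⊆ {z | Monotone (fun i => (z i).1) ∧
      Monotone (fun i => (z (τ⁻¹ i)).2)} :=
    closure_minimal (fun z hz => ⟨hz.1.monotone, hz.2.monotone⟩)
      ((isClosed_monotone.preimage hc₁).inter (isClosed_monotone.preimage hc₂))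
  rw [hopen.frontier_eq]
  rintro z ⟨hz, hnot⟩
  by_contra hcon
  simp only [Set.mem_union, Set.mem_ofPred_eq, not_or, not_not] at hcon
  exact hnot ⟨(hcl hz).1.strictMono_of_injective hcon.1,
    (hcl hz).2.strictMono_of_injective (hcon.2.comp (τ⁻¹).injective)⟩

lemma IsPermuton.measure_frontier_patternSet {μ : Measure (I × I)} (h : IsPermuton μ) {k : ℕ}
    (τ : Equiv.Perm (Fin k)) :
    Measure.pi (fun _ : Fin k => μ) (frontier (patternSet τ)) = 0 := by
  have := h.isProbabilityMeasure
  exact measure_mono_null (frontier_patternSet_subset τ) (measure_union_null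
    (measure_pi_setOf_not_injective μ measurable_fst h.map_fst)
    (measure_pi_setOf_not_injective μ measurable_snd h.map_snd))

lemma measurableSet_patternSet {k : ℕ} (τ : Equiv.Perm (Fin k)) :
    MeasurableSet (patternSet τ) := by
  have hc₁ : Continuous fun (z : Fin k → I × I) i => (z i).1 := by fun_prop
  have hc₂ : Continuous fun (z : Fin k → I × I) i => (z (τ⁻¹ i)).2 := by fun_prop
  exact ((isOpen_setOf_strictMono.preimage hc₁).inter
    (isOpen_setOf_strictMono.preimage hc₂)).measurableSet

/-! ### Pattern densities of graph measures and of their limits -/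

lemma graphPoint_mem_patternSet_iff {k n : ℕ} (τ : Equiv.Perm (Fin k)) (π : Equiv.Perm (Fin n))
    (x : Fin k → Fin n) :
    (fun i => graphPoint π (x i)) ∈ patternSet τ ↔ x ∈ occurrences τ π := by
  have h₁ : StrictMono (fun i => gridPoint (x i)) ↔ StrictMono x :=
    ⟨fun h i j hij => gridPoint_strictMono.lt_iff_lt.1 (h hij),
      fun h => gridPoint_strictMono.comp h⟩
  have h₂ : StrictMono (fun i => gridPoint (π (x (τ⁻¹ i)))) ↔
      ∀ i j, π (x i) ≤ π (x j) ↔ τ i ≤ τ j := by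
    constructor
    · intro h i j
      rw [← gridPoint_strictMono.le_iff_le]
      simpa using h.le_iff_le (a := τ i) (b := τ j)
    · intro h i j hij
      refine gridPoint_strictMono (lt_of_not_ge fun hle => ?_)
      have := (h _ _).1 hle
      rw [show τ (τ⁻¹ j) = j from τ.apply_symm_apply j,
        show τ (τ⁻¹ i) = i from τ.apply_symm_apply i] at this
      exact absurd hij this.not_gt
  exact and_congr h₁ h₂

/-- Points are drawn with replacement, so each of the `n ^ k` tuples has equal weight; hence `n ^ k`
rather than a binomial coefficient. -/
lemma permutonDensity_graphMeasure {k n : ℕ} [NeZero n] (τ : Equiv.Perm (Fin k))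
    (π : Equiv.Perm (Fin n)) :
    permutonDensity τ (graphMeasure π : Measure (I × I)) =
      k.factorial * (copies τ π / (n : ℝ) ^ k) := by
  have hpi : Measure.pi (fun _ : Fin k => (graphMeasure π : Measure (I × I))) =
      (Measure.pi fun _ : Fin k => uniformFin n).map fun x i => graphPoint π (x i) := by
    have : ∀ _ : Fin k, SigmaFinite ((uniformFin n).map (graphPoint π)) := fun _ =>
      have := Measure.isProbabilityMeasure_map (μ := uniformFin n) (f := graphPoint π)
        (measurable_of_finite _).aemeasurable
      inferInstance
    exact (Measure.pi_map_pi (f := fun _ : Fin k => graphPoint π)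
      fun _ => (measurable_of_finite _).aemeasurable).symm
  rw [permutonDensity, hpi, map_measureReal_apply (measurable_of_finite _)
    (measurableSet_patternSet τ)]
  have hpre : (fun (x : Fin k → Fin n) i => graphPoint π (x i)) ⁻¹' patternSet τ =
      occurrences τ π := Set.ext fun x => graphPoint_mem_patternSet_iff τ π x
  have hfin : (occurrences τ π).Finite := Set.toFinite _
  rw [hpre, copies, Set.ncard_eq_toFinset_card _ hfin]
  congr 1
  conv_lhs => rw [← hfin.coe_toFinset, ← sum_measureReal_singleton]
  simp [Measure.real, Measure.pi_singleton, uniformFin_singleton, div_eq_mul_inv]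

lemma tendsto_density_of_tendsto_permutonDensity {k : ℕ} (τ : Equiv.Perm (Fin k))
    (π : (n : ℕ) → Equiv.Perm (Fin n)) {φ : ℕ → ℕ} (hφ : Tendsto φ atTop atTop) {L : ℝ}
    (h : Tendsto (fun n => permutonDensity τ (graphMeasure (π (φ n + 1)) : Measure (I × I)))
      atTop (𝓝 L)) :
    Tendsto (fun n => density τ (π (φ n + 1))) atTop (𝓝 L) := by
  have hφ' : Tendsto (fun n => φ n + 1) atTop atTop := (tendsto_add_atTop_nat 1).comp hφ
  have hratio : Tendsto (fun n : ℕ => ((n : ℝ) ^ k / k.factorial) / (n.choose k : ℝ))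
      atTop (𝓝 1) := by
    refine (Asymptotics.isEquivalent_iff_tendsto_one ?_).1 (isEquivalent_choose k).symm
    filter_upwards [eventually_ge_atTop k] with n hn
    exact_mod_cast (Nat.choose_pos hn).ne'
  have := h.mul (hratio.comp hφ')
  rw [mul_one] at this
  refine this.congr' ?_
  filter_upwards [hφ'.eventually_ge_atTop k] with n hn
  have h1 : ((φ n + 1 : ℕ) : ℝ) ≠ 0 := by positivity
  have h2 : (k.factorial : ℝ) ≠ 0 := by exact_mod_cast k.factorial_ne_zero
  rw [permutonDensity_graphMeasure, density, if_pos hn, Function.comp_apply]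
  field_simp

/-- Finite products are weakly continuous, and the portmanteau theorem applies to sets with null
boundary. -/
lemma tendsto_permutonDensity {ι : Type*} {l : Filter ι} {ν : ι → ProbabilityMeasure (I × I)}
    {μ : ProbabilityMeasure (I × I)} (h : Tendsto ν l (𝓝 μ))
    (hμ : IsPermuton (μ : Measure (I × I))) {k : ℕ} (τ : Equiv.Perm (Fin k)) :
    Tendsto (fun i => permutonDensity τ (ν i : Measure (I × I))) l
      (𝓝 (permutonDensity τ (μ : Measure (I × I)))) := by
  have hpi : Tendsto (fun i => ProbabilityMeasure.pi fun _ : Fin k => ν i) l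
      (𝓝 (ProbabilityMeasure.pi fun _ : Fin k => μ)) :=
    (ProbabilityMeasure.continuous_pi.tendsto _).comp (tendsto_pi_nhds.2 fun _ => h)
  have hm := ProbabilityMeasure.tendsto_measure_of_null_frontier_of_tendsto' hpi
    (E := patternSet τ) (hμ.measure_frontier_patternSet τ)
  exact ((ENNReal.tendsto_toReal (measure_ne_top _ _)).comp hm).const_mul _

end PermLimit

theorem mainTheorem8 (σ : (n : ℕ) → Equiv.Perm (Fin n)) (hσ : PermLimit.IsConvergent σ) :
    ∃ μ : MeasureTheory.Measure (unitInterval × unitInterval),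
      PermLimit.IsPermuton μ ∧ PermLimit.ConvergesTo σ μ := by
  -- The shift by one avoids the empty permutation, whose graph carries no probability measure.
  obtain ⟨μ, φ, hφ, hlim⟩ :=
    CompactSpace.tendsto_subseq fun n : ℕ => PermLimit.graphMeasure (σ (n + 1))
  have hgrid := PermLimit.tendsto_gridMeasure.comp hφ.tendsto_atTop
  have hμ : PermLimit.IsPermuton (μ : Measure (unitInterval × unitInterval)) :=
    PermLimit.isPermuton_of_map_eq
      (PermLimit.map_eq_volume_of_tendsto hlim continuous_fst
        (hgrid.congr fun n => (PermLimit.map_fst_graphMeasure _).symm))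
      (PermLimit.map_eq_volume_of_tendsto hlim continuous_snd
        (hgrid.congr fun n => (PermLimit.map_snd_graphMeasure _).symm))
  refine ⟨μ, hμ, fun k τ => ?_⟩
  obtain ⟨L, hL⟩ := hσ k τ
  have hsub := PermLimit.tendsto_density_of_tendsto_permutonDensity τ σ hφ.tendsto_atTop
    (PermLimit.tendsto_permutonDensity hlim hμ τ)
  have hL' := hL.comp ((tendsto_add_atTop_nat 1).comp hφ.tendsto_atTop)
  exact tendsto_nhds_unique hL' hsub ▸ hL
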